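/- Let $X$ be a Riemann surface (for instance a compact one of genus $g\ge 2$) and let $\pi : L \to X$ be a holomorphic line bundle (for instance a basepoint-free one of positive degree), with total space $\operatorname{Tot}(L)$. For $i \ge 0$ write $L^{i} = L^{\otimes i}$ and $L^{-i} = (L^{i})^{*}$, and let $\lambda$ be the tautological section of $\pi^*L$ on $\operatorname{Tot}(L)$, whose value at a point $y$ of the fibre $L_x$ is $y$ itself. Let $n \ge 0$ be an integer, let $a_i \in H^0(X, L^i)$ for $i = 1, \dots, n$ be holomorphic sections, and let $$p(\lambda) = \lambda^n + \pi^*(a_1)\lambda^{n-1} + \cdots + \pi^*(a_n),$$ a holomorphic section of $\pi^*(L^n)$ on $\operatorname{Tot}(L)$. Let $S \subset \operatorname{Tot}(L)$ be the zero locus of $p(\lambda)$ and assume that the divisor of $p(\lambda)$ is smooth, that is, in local trivializations of $L$ the differential of $p(\lambda)$ does not vanish at any point of $S$. Let $\mathcal{O}_S$ be the sheaf of holomorphic functions on $S$ (the functions that are locally restrictions of holomorphic functions on open subsets of $\operatorname{Tot}(L)$), and denote the restrictions of $\pi$ and $\lambda$ to $S$ again by $\pi$ and $\lambda$. Then the map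 $$\mathcal{O}_X \oplus L^{-1} \oplus \cdots \oplus L^{-(n-1)} \to \pi_*\mathcal{O}_S, \qquad (c_0, c_1, \dots, c_{n-1}) \mapsto c_0 + c_1\lambda + \cdots + c_{n-1}\lambda^{n-1},$$ is an isomorphism of sheaves of $\mathcal{O}_X$-modules: for every open $U \subseteq X$ it is an $\mathcal{O}_X(U)$-linear bijection from the $n$-tuples of holomorphic sections $c_i$ of $L^{-i}$ over $U$ onto $\mathcal{O}_S(\pi^{-1}(U))$, and these bijections commute with restriction to smaller open sets. (For $n = 0$, $S$ is empty and both sides are $0$.) -/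

import Mathlib

open Bundle Manifold TopologicalSpace
open scoped Manifold ContDiff TensorProduct

noncomputable section

namespace SpectralCurve

section Bundles

variable {X : Type*} [TopologicalSpace X] [ChartedSpace ℂ X]
  (L : X → Type*) [∀ x, AddCommGroup (L x)] [∀ x, Module ℂ (L x)]
  [∀ x, TopologicalSpace (L x)] [TopologicalSpace (TotalSpace ℂ L)]
  [FiberBundle ℂ L] [VectorBundle ℂ ℂ L]

/-- The ring `𝒪_X(U)` of holomorphic functions on the open subset `U` of `X`. -/
def holFun (U : Opens X) : Subring (U → ℂ) where
  carrier := {f | ContMDiff 𝓘(ℂ) 𝓘(ℂ) ω f}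
  mul_mem' hf hg := ContMDiff.mul hf hg
  one_mem' := contMDiff_const
  add_mem' hf hg := ContMDiff.add hf hg
  zero_mem' := contMDiff_const
  neg_mem' hf := ContMDiff.neg hf

variable {L} in
/-- The local frame of `L` over the base set of a trivialization `e` that `e` sends to `1`. -/
def frame (e : Trivialization ℂ (π ℂ L)) (x : X) : L x := e.symm x (1 : ℂ)

variable {L} in
/-- The `k`-th tensor power `L_x^{⊗k} → ℂ` of the linear map `e_x : L_x → ℂ` given by a
trivialization `e`, that is, the trivialization of `L^k` induced by `e`. -/
def powCoord (e : Trivialization ℂ (π ℂ L)) [MemTrivializationAtlas e] (k : ℕ) (x : X) :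
    (⨂[ℂ]^k (L x)) →ₗ[ℂ] ℂ :=
  PiTensorProduct.lift
    ((MultilinearMap.mkPiAlgebra ℂ (Fin k) ℂ).compLinearMap fun _ => e.linearMapAt ℂ x)

/-- `a` is a global holomorphic section of `L^k`: it is holomorphic in each of the local
trivializations of `L^k` induced by those of `L`. -/
def IsHolSection (k : ℕ) (a : (x : X) → ⨂[ℂ]^k (L x)) : Prop :=
  ∀ (e : Trivialization ℂ (π ℂ L)) [MemTrivializationAtlas e],
    ContMDiffOn 𝓘(ℂ) 𝓘(ℂ) ω (fun x => powCoord e k x (a x)) e.baseSet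

/-- The fibre at `x` of `L^{-k}`, the dual of `L^k` (so `L^0` is the trivial bundle, through
evaluation at the empty tensor). -/
abbrev NegPow (k : ℕ) (x : X) : Type _ := Module.Dual ℂ (⨂[ℂ]^k (L x))

/-- The `𝒪_X(U)`-module of holomorphic sections of `L^{-k}` over `U`. The value at `x` of a section
`c` in the local trivialization induced by `e` is `c(x)(s(x)^{⊗k})`, `s` the frame given by `e`. -/
def negPowSections (k : ℕ) (U : Opens X) : Submodule (holFun U) ((x : U) → NegPow L k x) where
  carrier := {c | ∀ (e : Trivialization ℂ (π ℂ L)) [MemTrivializationAtlas e],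
    ContMDiffOn 𝓘(ℂ) 𝓘(ℂ) ω
      (fun x : U => c x (PiTensorProduct.tprod ℂ fun _ : Fin k => frame e (x : X)))
      {x : U | (x : X) ∈ e.baseSet}}
  add_mem' hf hg _ _ := (hf _).add (hg _)
  zero_mem' _ _ := contMDiffOn_const
  smul_mem' r _ hf e _ := (ContMDiff.contMDiffOn r.2).mul (hf e)

/-- The `k`-th power of the tautological section `λ` of the pullback of `L` to `Tot(L)`; its value
at a point `y` of the fibre `L_x` is `y^{⊗k} ∈ L_x^{⊗k}`. -/
def tautPow (k : ℕ) (y : TotalSpace ℂ L) : ⨂[ℂ]^k (L y.proj) :=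
  PiTensorProduct.tprod ℂ fun _ => y.2

variable {L} {n : ℕ}

/-- The section `p(λ) = λ^n + a_1 λ^{n-1} + ⋯ + a_n` of the pullback of `L^n` to `Tot(L)`.
The section `a_{j+1}` of `L^{j+1}` is `a j`, for `j = 0, …, n - 1`. -/
def poly (a : (j : Fin n) → (x : X) → ⨂[ℂ]^((j : ℕ) + 1) (L x)) (y : TotalSpace ℂ L) :
    ⨂[ℂ]^n (L y.proj) :=
  tautPow L n y + ∑ j : Fin n,
    TensorPower.cast ℂ (L y.proj) (by omega : ((j : ℕ) + 1) + (n - ((j : ℕ) + 1)) = n)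
      (TensorPower.mulEquiv (a j y.proj ⊗ₜ[ℂ] tautPow L (n - ((j : ℕ) + 1)) y))

/-- The spectral curve `S`, the zero locus of `p(λ)` in `Tot(L)`. -/
def curve (a : (j : Fin n) → (x : X) → ⨂[ℂ]^((j : ℕ) + 1) (L x)) : Set (TotalSpace ℂ L) :=
  {y | poly a y = 0}

/-- The divisor of `p(λ)` is smooth: in local trivializations of `L^n`, the differential of `p(λ)`
does not vanish at any point of `S`. -/
def IsSmoothCurve (a : (j : Fin n) → (x : X) → ⨂[ℂ]^((j : ℕ) + 1) (L x)) : Prop :=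
  ∀ y ∈ curve a, ∀ (e : Trivialization ℂ (π ℂ L)) [MemTrivializationAtlas e],
    y.proj ∈ e.baseSet →
      mfderiv (𝓘(ℂ).prod 𝓘(ℂ)) 𝓘(ℂ) (fun z => powCoord e n z.proj (poly a z)) y ≠ 0

/-- The ring `𝒪_S(W)` of holomorphic functions on an open subset `W` of an analytic subset `S` of
`Tot(L)`: the functions that are locally restrictions of holomorphic functions on open subsets
of `Tot(L)`. -/
def holFunCurve (S : Set (TotalSpace ℂ L)) (W : Opens S) : Subring (W → ℂ) where
  carrier := {f | ∀ w : W, ∃ (N : Set (TotalSpace ℂ L)) (F : TotalSpace ℂ L → ℂ),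
    IsOpen N ∧ ((w : S) : TotalSpace ℂ L) ∈ N ∧
      ContMDiffOn (𝓘(ℂ).prod 𝓘(ℂ)) 𝓘(ℂ) ω F N ∧
      ∀ v : W, ((v : S) : TotalSpace ℂ L) ∈ N → f v = F ((v : S) : TotalSpace ℂ L)}
  mul_mem' hf hg w := by
    obtain ⟨N, F, hN, hw, hF, h⟩ := hf w
    obtain ⟨N', F', hN', hw', hF', h'⟩ := hg w
    exact ⟨N ∩ N', F * F', hN.inter hN', ⟨hw, hw'⟩,
      (hF.mono Set.inter_subset_left).mul (hF'.mono Set.inter_subset_right),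
      fun v hv => by simp [h v hv.1, h' v hv.2]⟩
  one_mem' _ := ⟨Set.univ, 1, isOpen_univ, trivial, contMDiffOn_const, fun _ _ => rfl⟩
  add_mem' hf hg w := by
    obtain ⟨N, F, hN, hw, hF, h⟩ := hf w
    obtain ⟨N', F', hN', hw', hF', h'⟩ := hg w
    exact ⟨N ∩ N', F + F', hN.inter hN', ⟨hw, hw'⟩,
      (hF.mono Set.inter_subset_left).add (hF'.mono Set.inter_subset_right),
      fun v hv => by simp [h v hv.1, h' v hv.2]⟩
  zero_mem' _ := ⟨Set.univ, 0, isOpen_univ, trivial, contMDiffOn_const, fun _ _ => rfl⟩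
  neg_mem' hf w := by
    obtain ⟨N, F, hN, hw, hF, h⟩ := hf w
    exact ⟨N, -F, hN, hw, hF.neg, fun v hv => by simp [h v hv]⟩

/-- The projection `π : S → X`. -/
def proj (S : Set (TotalSpace ℂ L)) : C(S, X) :=
  ⟨fun y => (y : TotalSpace ℂ L).proj,
    (FiberBundle.continuous_proj ℂ L).comp continuous_subtype_val⟩

/-- The open subset `π⁻¹(U)` of `S`. -/
abbrev preim (S : Set (TotalSpace ℂ L)) (U : Opens X) : Opens S := Opens.comap (proj S) U

/-- The ring `(π_* 𝒪_S)(U) = 𝒪_S(π⁻¹(U))`. -/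
abbrev pushforward (S : Set (TotalSpace ℂ L)) (U : Opens X) : Subring (preim S U → ℂ) :=
  holFunCurve S (preim S U)

/-- The projection of `w ∈ π⁻¹(U)` to `U`. -/
def projOn (S : Set (TotalSpace ℂ L)) (U : Opens X) (w : preim S U) : U := ⟨proj S w.1, w.2⟩

lemma contMDiffOn_extend {U : Opens X} {f : U → ℂ} {A : Set X}
    (hf : ContMDiffOn 𝓘(ℂ) 𝓘(ℂ) ω f {x : U | (x : X) ∈ A}) (hA : IsOpen A) :
    ContMDiffOn 𝓘(ℂ) 𝓘(ℂ) ω (Function.extend (Subtype.val : U → X) f 0) (A ∩ U) := by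
  rintro x ⟨hxA, hxU⟩
  have h1 : ContMDiffAt 𝓘(ℂ) 𝓘(ℂ) ω f ⟨x, hxU⟩ :=
    (hf ⟨x, hxU⟩ hxA).contMDiffAt ((hA.preimage continuous_subtype_val).mem_nhds hxA)
  have h2 : f = fun z : U => Function.extend (Subtype.val : U → X) f 0 z := by
    funext z
    exact (Subtype.val_injective.extend_apply f 0 z).symm
  rw [h2] at h1
  exact (contMDiffAt_subtype_iff.1 h1).contMDiffWithinAt

/-- The ring homomorphism `π^# : 𝒪_X(U) → (π_* 𝒪_S)(U)`, which makes `π_* 𝒪_S` a sheaf of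
`𝒪_X`-modules. -/
def pullback [IsManifold 𝓘(ℂ) ω X] [ContMDiffVectorBundle ω ℂ L 𝓘(ℂ)]
    (S : Set (TotalSpace ℂ L)) (U : Opens X) : holFun U →+* pushforward S U where
  toFun f := ⟨fun w => f.1 (projOn S U w), fun w => by
    refine ⟨π ℂ L ⁻¹' U, fun y => Function.extend (Subtype.val : U → X) f.1 0 y.proj,
      U.2.preimage (FiberBundle.continuous_proj ℂ L), w.2, ?_, fun v hv => ?_⟩
    · have h := contMDiffOn_extend (A := Set.univ) (ContMDiff.contMDiffOn f.2) isOpen_univ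
      exact h.comp (contMDiff_proj L).contMDiffOn fun y hy => ⟨trivial, hy⟩
    · exact (Subtype.val_injective.extend_apply f.1 0 (projOn S U v)).symm⟩
  map_one' := rfl
  map_mul' _ _ := rfl
  map_zero' := rfl
  map_add' _ _ := rfl

lemma snd_eq_smul_frame {X : Type*} [TopologicalSpace X] {L : X → Type*}
    [∀ x, AddCommGroup (L x)] [∀ x, Module ℂ (L x)] [∀ x, TopologicalSpace (L x)]
    [TopologicalSpace (TotalSpace ℂ L)] [FiberBundle ℂ L] [VectorBundle ℂ ℂ L] (e : Trivialization ℂ (π ℂ L)) [MemTrivializationAtlas e]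
    (y : TotalSpace ℂ L) (hy : y.proj ∈ e.baseSet) :
    y.2 = (e y).2 • frame e y.proj := by
  have h := e.symmₗ_linearMapAt (R := ℂ) hy y.2
  have h2 : e.linearMapAt ℂ y.proj y.2 = (e y).2 := by
    rw [Trivialization.linearMapAt_apply, if_pos hy]
  rw [h2] at h
  have h3 := (e.symmₗ ℂ y.proj).map_smul (e y).2 (1 : ℂ)
  rw [smul_eq_mul, mul_one, h] at h3
  rw [h3, frame, Trivialization.symmₗ_apply e hy]

lemma sum_mem [IsManifold 𝓘(ℂ) ω X] [ContMDiffVectorBundle ω ℂ L 𝓘(ℂ)]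
    (S : Set (TotalSpace ℂ L)) (U : Opens X) (c : (i : Fin n) → negPowSections L i U) :
    (fun w : preim S U =>
      ∑ i : Fin n, (c i).1 (projOn S U w) (tautPow L i ((w : S) : TotalSpace ℂ L)))
      ∈ pushforward S U := by
  intro w
  set e := trivializationAt ℂ L (proj S w.1)
  let g : Fin n → X → ℂ := fun i => Function.extend (Subtype.val : U → X)
    (fun x : U => (c i).1 x (PiTensorProduct.tprod ℂ fun _ : Fin i => frame e (x : X))) 0
  have hg : ∀ i, ContMDiffOn 𝓘(ℂ) 𝓘(ℂ) ω (g i) (e.baseSet ∩ U) := fun i =>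
    contMDiffOn_extend ((c i).2 e) e.open_baseSet
  refine ⟨π ℂ L ⁻¹' (e.baseSet ∩ U), fun y => ∑ i : Fin n, g i y.proj * (e y).2 ^ (i : ℕ),
    (e.open_baseSet.inter U.2).preimage (FiberBundle.continuous_proj ℂ L),
    ⟨FiberBundle.mem_baseSet_trivializationAt' _, w.2⟩, ?_, fun v hv => ?_⟩
  · have h2 : ContMDiffOn (𝓘(ℂ).prod 𝓘(ℂ)) 𝓘(ℂ) ω (fun y : TotalSpace ℂ L => (e y).2)
        (π ℂ L ⁻¹' (e.baseSet ∩ U)) := by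
      have := (Trivialization.contMDiffOn (IB := 𝓘(ℂ)) (n := ω) e)
      exact (contMDiff_snd.comp_contMDiffOn this).mono fun y hy => e.mem_source.2 hy.1
    refine contMDiffOn_finsetSum fun i _ => ContMDiffOn.mul ?_ (h2.pow i)
    exact (hg i).comp (contMDiff_proj L).contMDiffOn fun y hy => hy
  · refine Finset.sum_congr rfl fun i _ => ?_
    have h1 : g i (v : S).1.proj = (c i).1 (projOn S U v)
        (PiTensorProduct.tprod ℂ fun _ : Fin i => frame e (v : S).1.proj) :=
      Subtype.val_injective.extend_apply (fun x : U => (c i).1 x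
        (PiTensorProduct.tprod ℂ fun _ : Fin i => frame e (x : X))) 0 (projOn S U v)
    rw [h1, tautPow]
    have h3 := snd_eq_smul_frame e ((v : S) : TotalSpace ℂ L) hv.1
    have h4 : (PiTensorProduct.tprod ℂ fun _ : Fin i => (v : S).1.2) =
        PiTensorProduct.tprod ℂ fun _ : Fin i => (e (v : S).1).2 • frame e (v : S).1.proj :=
      congrArg (PiTensorProduct.tprod ℂ) (funext fun _ => h3)
    rw [h4, MultilinearMap.map_smul_univ]
    refine (((c i).1 (projOn S U v)).map_smul _ _).trans ?_
    rw [Finset.prod_const, Finset.card_univ, Fintype.card_fin, smul_eq_mul, mul_comm]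
    rfl

/-- The map `𝒪_X ⊕ L^{-1} ⊕ ⋯ ⊕ L^{-(n-1)} → π_* 𝒪_S`, `(c_0, …, c_{n-1}) ↦ ∑ c_i λ^i`, on sections
over `U`. It is linear over `𝒪_X(U)`, which acts on `(π_* 𝒪_S)(U)` through `π^#`. -/
def sumMap [IsManifold 𝓘(ℂ) ω X] [ContMDiffVectorBundle ω ℂ L 𝓘(ℂ)]
    (a : (j : Fin n) → (x : X) → ⨂[ℂ]^((j : ℕ) + 1) (L x)) (U : Opens X) :
    ((i : Fin n) → negPowSections L i U) →ₛₗ[pullback (curve a) U] pushforward (curve a) U where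
  toFun c := ⟨fun w => ∑ i : Fin n,
    (c i).1 (projOn (curve a) U w) (tautPow L i ((w : curve a) : TotalSpace ℂ L)),
    sum_mem (curve a) U c⟩
  map_add' c d := by
    ext w
    exact Finset.sum_add_distrib (s := Finset.univ)
      (f := fun i : Fin n => (c i).1 (projOn (curve a) U w)
        (tautPow L i ((w : curve a) : TotalSpace ℂ L)))
      (g := fun i : Fin n => (d i).1 (projOn (curve a) U w)
        (tautPow L i ((w : curve a) : TotalSpace ℂ L)))
  map_smul' r c := by
    ext w
    exact (Finset.mul_sum Finset.univ
      (fun i : Fin n => (c i).1 (projOn (curve a) U w)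
        (tautPow L i ((w : curve a) : TotalSpace ℂ L))) (r.1 (projOn (curve a) U w))).symm

variable (L) in
/-- Restriction of sections of `L^{-k}` from `U` to `V ⊆ U`. -/
def resNegPow (k : ℕ) {U V : Opens X} (h : V ≤ U) (c : negPowSections L k U) :
    negPowSections L k V :=
  ⟨fun x => c.1 ⟨x, h x.2⟩, fun e _ => (c.2 e).comp
    (contMDiff_inclusion h).contMDiffOn fun _ hx => hx⟩

/-- Restriction of sections of `π_* 𝒪_S` from `U` to `V ⊆ U`. -/
def resPushforward (S : Set (TotalSpace ℂ L)) {U V : Opens X} (h : V ≤ U)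
    (f : pushforward S U) : pushforward S V :=
  ⟨fun w => f.1 ⟨w.1, h w.2⟩, fun w => by
    obtain ⟨N, F, hN, hw, hF, hv⟩ := f.2 ⟨w.1, h w.2⟩
    exact ⟨N, F, hN, hw, hF, fun v hvN => hv ⟨v.1, h v.2⟩ hvN⟩⟩

end Bundles

end SpectralCurve

end

open SpectralCurve

/-!
In a chart of `X` and a trivialization of `L` the section `p(λ)` becomes a monic polynomial
`P (x, t) = t ^ n + ∑ k, b k x * t ^ k` with coefficients holomorphic in `x` (`powCoord_poly`), and
`S` becomes its zero locus. The two halves of the theorem are local statements about `P`.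

Injectivity (`coeff_eq_zero_of_smooth`). Let `R (x, t) = ∑ k, c k x * t ^ k` vanish on the zero
locus of `P`. Where the differential of `P` is nonzero, the distance of a point to the zero locus
is `O(P)`, by the quantitative open mapping property of strictly differentiable maps; as `R` is
Lipschitz, `R = O(P)` near each point of `S` (`isBigO_of_eq_zero_on_zeros`). Restricted to the fibre
over `x`, this says that each root of `P (x, ·)` is a root of `R (x, ·)` with at least the same
multiplicity, so the polynomial `R (x, ·)`, of degree `< n`, is zero. The argument is the same at
branch points and elsewhere.

Surjectivity (`exists_analyticAt_coeff`). Let `t` run over the roots of `P (x₀, ·)`, and let `F t`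
be a holomorphic extension of the given function near `(x₀, t)`. For `x` near `x₀` all roots of
`P (x, ·)` lie in small disjoint discs around the `t`, and
`R (x, τ) = ∑ t, (2πi)⁻¹ ∮ F t (x, s) / P (x, s) * (P (x, s) - P (x, τ)) / (s - τ) ds`,
integrated over the boundary circles, is a polynomial in `τ` of degree `< n` with coefficients
holomorphic in `x`. At a root `τ` of `P (x, ·)` the integrand is the Cauchy kernel, so `R (x, τ)` is
the value of the given function.

By injectivity over smaller open sets the local preimages agree on overlaps and glue
(`sumMap_surjective`).
-/

namespace SpectralCurve

open Filter Topology Asymptotics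

/-! ### Functions vanishing on a smooth zero locus -/

/-- A strictly differentiable function with nonzero differential, vanishing at `u`, is metrically
regular: near `u` the distance of `p` to the zero locus is at most `C * ‖f p‖`, and is witnessed by
zeros in any prescribed neighbourhood `N` of `u`. -/
lemma exists_zero_dist_le {E : Type*} [NormedAddCommGroup E] [NormedSpace ℂ E] [CompleteSpace E]
    {f : E → ℂ} {f' : E →L[ℂ] ℂ} {u : E} (hf : HasStrictFDerivAt f f' u) (hf' : f' ≠ 0)
    (hu : f u = 0) {N : Set E} (hN : N ∈ 𝓝 u) :
    ∃ C : ℝ, ∀ᶠ p in 𝓝 u, ∃ q ∈ N, f q = 0 ∧ dist q p ≤ C * ‖f p‖ := by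
  have hsurj : (f' : E →ₗ[ℂ] ℂ).range = ⊤ := by
    refine LinearMap.range_eq_top.2 (LinearMap.surjective fun h => hf' ?_)
    ext x
    exact LinearMap.congr_fun h x
  set g := f'.nonlinearRightInverseOfSurjective hsurj
  have hg : 0 < (g.nnnorm : ℝ) := by
    exact_mod_cast f'.nonlinearRightInverseOfSurjective_nnnorm_pos hsurj
  obtain ⟨s, hs, happ⟩ := hf.approximates_deriv_on_nhds (c := g.nnnorm⁻¹ / 2)
    (Or.inr (half_pos (inv_pos.2 (by exact_mod_cast hg))))
  obtain ⟨r, hr, hrs⟩ := Metric.mem_nhds_iff.1 (inter_mem hs hN)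
  have hcont : ContinuousAt f u := hf.continuousAt
  have h1 : ∀ᶠ p in 𝓝 u, 2 * (g.nnnorm : ℝ) * ‖f p‖ < r / 2 := by
    have : Tendsto (fun p => 2 * (g.nnnorm : ℝ) * ‖f p‖) (𝓝 u) (𝓝 (2 * (g.nnnorm : ℝ) * ‖f u‖)) :=
      (hcont.norm).const_mul _
    rw [hu, norm_zero, mul_zero] at this
    exact this.eventually_lt_const (half_pos hr)
  refine ⟨2 * g.nnnorm, ?_⟩
  filter_upwards [h1, Metric.ball_mem_nhds u (half_pos hr)] with p hp hpu
  have hsub : Metric.closedBall p (2 * (g.nnnorm : ℝ) * ‖f p‖) ⊆ s ∩ N := by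
    refine Set.Subset.trans (fun q hq => ?_) hrs
    rw [Metric.mem_closedBall] at hq
    rw [Metric.mem_ball] at hpu ⊢
    linarith [dist_triangle q p u]
  have := happ.surjOn_closedBall_of_nonlinearRightInverse g (b := p)
    (ε := 2 * (g.nnnorm : ℝ) * ‖f p‖) (by positivity) (hsub.trans Set.inter_subset_left)
  have h0 : (0 : ℂ) ∈ Metric.closedBall (f p)
      ((((g.nnnorm : ℝ)⁻¹ - ((g.nnnorm⁻¹ / 2 : NNReal) : ℝ))) * (2 * (g.nnnorm : ℝ) * ‖f p‖)) := by
    rw [Metric.mem_closedBall, dist_zero_left]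
    push_cast
    apply le_of_eq
    field_simp
    ring
  obtain ⟨q, hq, hq0⟩ := this h0
  exact ⟨q, (hsub hq).2, hq0, hq⟩

/-- A function vanishing on the zero locus of `f` is `O(f)` near a smooth point of that locus. -/
lemma isBigO_of_eq_zero_on_zeros {E : Type*} [NormedAddCommGroup E] [NormedSpace ℂ E]
    [CompleteSpace E] {f g : E → ℂ} {f' g' : E →L[ℂ] ℂ} {u : E}
    (hf : HasStrictFDerivAt f f' u) (hf' : f' ≠ 0) (hu : f u = 0)
    (hg : HasStrictFDerivAt g g' u) (h : ∀ᶠ p in 𝓝 u, f p = 0 → g p = 0) :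
    g =O[𝓝 u] f := by
  obtain ⟨K, s, hs, hK⟩ := hg.exists_lipschitzOnWith
  obtain ⟨C, hC⟩ := exists_zero_dist_le hf hf' hu (inter_mem hs h)
  refine IsBigO.of_bound (K * C) ?_
  filter_upwards [hC, hs] with p ⟨q, ⟨hqs, hq⟩, hq0, hd⟩ hps
  have h1 := hK.dist_le_mul p hps q hqs
  rw [hq hq0, dist_zero_right, dist_comm] at h1
  rw [mul_assoc]
  exact h1.trans (mul_le_mul_of_nonneg_left hd K.2)

/-! ### Divisibility of polynomials from local estimates -/

open Polynomial in
lemma rootMultiplicity_le_of_isBigO {p r : ℂ[X]} (hr : r ≠ 0) (t : ℂ)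
    (h : (fun s => r.eval s) =O[𝓝 t] fun s => p.eval s) :
    p.rootMultiplicity t ≤ r.rootMultiplicity t := by
  by_contra! hlt
  have hp : p ≠ 0 := by
    rintro rfl
    simp at hlt
  obtain ⟨q, hq, -⟩ := exists_eq_pow_rootMultiplicity_mul_and_not_dvd p hp t
  obtain ⟨v, hv, hv'⟩ := exists_eq_pow_rootMultiplicity_mul_and_not_dvd r hr t
  refine hv' (dvd_iff_isRoot.2 ?_)
  obtain ⟨d, hd⟩ := Nat.exists_eq_add_of_lt hlt
  set k := r.rootMultiplicity t
  rw [hd] at hq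
  obtain ⟨C, hC⟩ := h.bound
  have h1 : ∀ᶠ s in 𝓝[≠] t, ‖v.eval s‖ ≤ C * (‖s - t‖ ^ (d + 1) * ‖q.eval s‖) := by
    filter_upwards [hC.filter_mono nhdsWithin_le_nhds, self_mem_nhdsWithin] with s hs hst
    have hpos : 0 < ‖s - t‖ ^ k := pow_pos (norm_pos_iff.2 (sub_ne_zero.2 hst)) _
    rw [hq, hv] at hs
    simp only [eval_mul, eval_pow, eval_sub, eval_X, eval_C, norm_mul, norm_pow] at hs
    rw [add_assoc, pow_add] at hs
    refine le_of_mul_le_mul_left (hs.trans (le_of_eq ?_)) hpos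
    ring
  have h2 : Tendsto (fun s => C * (‖s - t‖ ^ (d + 1) * ‖q.eval s‖)) (𝓝[≠] t) (𝓝 0) := by
    have : Continuous fun s => C * (‖s - t‖ ^ (d + 1) * ‖q.eval s‖) := by fun_prop
    have := (this.tendsto t).mono_left (nhdsWithin_le_nhds (s := {t}ᶜ))
    simpa using this
  have h3 : Tendsto (fun s => ‖v.eval s‖) (𝓝[≠] t) (𝓝 ‖v.eval t‖) :=
    (v.continuous.norm.tendsto t).mono_left nhdsWithin_le_nhds
  exact norm_le_zero_iff.1 (le_of_tendsto_of_tendsto h3 h2 h1)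

open Polynomial in
/-- A polynomial of degree less than that of `p` which is `O(p)` at the roots of `p` is zero. -/
lemma eq_zero_of_isBigO_of_natDegree_lt {p r : ℂ[X]} (hdeg : r.natDegree < p.natDegree)
    (h : ∀ t, p.eval t = 0 → (fun s => r.eval s) =O[𝓝 t] fun s => p.eval s) : r = 0 := by
  by_contra hr
  have hp : p ≠ 0 := by
    rintro rfl
    simp at hdeg
  have hle : p.roots ≤ r.roots := by
    refine Multiset.le_iff_count.2 fun t => ?_
    rw [count_roots, count_roots]
    by_cases ht : p.eval t = 0
    · exact rootMultiplicity_le_of_isBigO hr t (h t ht)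
    · rw [rootMultiplicity_eq_zero ht]
      exact Nat.zero_le _
  have h1 := Multiset.card_le_card hle
  rw [← (IsAlgClosed.splits p).natDegree_eq_card_roots] at h1
  exact absurd (h1.trans r.card_roots') (not_le.2 hdeg)

/-! ### Families of monic polynomials -/

/-- The family of monic polynomials `t ^ n + ∑ k, b k x * t ^ k` in `t` with coefficients
depending on `x`, evaluated at the pair `(x, t)`. -/
def monicFamily {n : ℕ} (b : Fin n → ℂ → ℂ) (p : ℂ × ℂ) : ℂ :=
  p.2 ^ n + ∑ k : Fin n, b k p.1 * p.2 ^ (k : ℕ)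

lemma analyticAt_sum_mul_pow {n : ℕ} {c : Fin n → ℂ → ℂ} {x : ℂ}
    (hc : ∀ k, AnalyticAt ℂ (c k) x) (t : ℂ) :
    AnalyticAt ℂ (fun p : ℂ × ℂ => ∑ k : Fin n, c k p.1 * p.2 ^ (k : ℕ)) (x, t) := by
  refine Finset.analyticAt_fun_sum _ fun k _ => ?_
  exact (AnalyticAt.fun_comp (f := Prod.fst) (hc k) analyticAt_fst).mul (analyticAt_snd.pow _)

lemma analyticAt_monicFamily {n : ℕ} {b : Fin n → ℂ → ℂ} {x : ℂ}
    (hb : ∀ k, AnalyticAt ℂ (b k) x) (t : ℂ) : AnalyticAt ℂ (monicFamily b) (x, t) :=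
  (analyticAt_snd.pow n).add (analyticAt_sum_mul_pow hb t)

lemma natDegree_sum_C_mul_X_pow_lt {n : ℕ} (hn : n ≠ 0) (c : Fin n → ℂ) :
    (∑ k : Fin n, Polynomial.C (c k) * Polynomial.X ^ (k : ℕ)).natDegree < n := by
  refine lt_of_le_of_lt (Polynomial.natDegree_sum_le_of_forall_le (n := n - 1) _ _ fun k _ => ?_)
    (by omega)
  exact (Polynomial.natDegree_C_mul_X_pow_le _ _).trans (by omega)

/-- If the zero locus of a monic family of degree `n` is smooth, a family of polynomials of
degree `< n` that vanishes on it is zero: it is `O` of the monic family at each root. -/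
theorem coeff_eq_zero_of_smooth {n : ℕ} {b c : Fin n → ℂ → ℂ} {x : ℂ}
    (hb : ∀ k, AnalyticAt ℂ (b k) x) (hc : ∀ k, AnalyticAt ℂ (c k) x)
    (hsm : ∀ t, monicFamily b (x, t) = 0 → fderiv ℂ (monicFamily b) (x, t) ≠ 0)
    (h : ∀ᶠ z in 𝓝 x, ∀ t, monicFamily b (z, t) = 0 → ∑ k : Fin n, c k z * t ^ (k : ℕ) = 0)
    (k : Fin n) : c k x = 0 := by
  have hn : n ≠ 0 := by
    rintro rfl
    exact k.elim0
  set r : Polynomial ℂ := ∑ k : Fin n, Polynomial.C (c k x) * Polynomial.X ^ (k : ℕ) with hr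
  set q : Polynomial ℂ := ∑ k : Fin n, Polynomial.C (b k x) * Polynomial.X ^ (k : ℕ) with hq
  have hreval : ∀ t, r.eval t = ∑ k : Fin n, c k x * t ^ (k : ℕ) := fun t => by
    simp [hr, Polynomial.eval_finsetSum]
  have hpeval : ∀ t, (Polynomial.X ^ n + q).eval t = monicFamily b (x, t) := fun t => by
    simp [hq, monicFamily, Polynomial.eval_finsetSum]
  have hpdeg : (Polynomial.X ^ n + q).natDegree = n := by
    rw [Polynomial.natDegree_add_eq_left_of_natDegree_lt, Polynomial.natDegree_X_pow]
    rw [Polynomial.natDegree_X_pow]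
    exact natDegree_sum_C_mul_X_pow_lt hn _
  have hr0 : r = 0 := by
    refine eq_zero_of_isBigO_of_natDegree_lt (p := Polynomial.X ^ n + q) ?_ fun t ht => ?_
    · rw [hpdeg]
      exact natDegree_sum_C_mul_X_pow_lt hn _
    · rw [hpeval] at ht
      have h1 := isBigO_of_eq_zero_on_zeros (analyticAt_monicFamily hb t).hasStrictFDerivAt
        (hsm t ht) ht (analyticAt_sum_mul_pow hc t).hasStrictFDerivAt
        (((continuous_fst.tendsto (x, t)).eventually h).mono fun p hp => hp p.2)
      have h2 : Tendsto (fun s : ℂ => (x, s)) (𝓝 t) (𝓝 (x, t)) :=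
        (Continuous.prodMk_right x).tendsto t
      simp only [hreval, hpeval]
      exact h1.comp_tendsto h2
  have h4 : r.coeff k = c k x := by
    rw [hr, Polynomial.finsetSum_coeff, Finset.sum_eq_single k]
    · simp
    · intro j _ hj
      rw [Polynomial.coeff_C_mul_X_pow, if_neg fun h => hj (Fin.ext h.symm)]
    · simp
  rw [← h4, hr0, Polynomial.coeff_zero]

/-! ### Holomorphic dependence of circle integrals on a parameter -/

lemma analyticAt_circleIntegral {G : ℂ × ℂ → ℂ} {x c : ℂ} {R : ℝ} (hR : 0 ≤ R)
    (hG : ∀ s ∈ Metric.sphere c R, AnalyticAt ℂ G (x, s)) :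
    AnalyticAt ℂ (fun z => ∮ s in C(c, R), G (z, s)) x := by
  have h1 : ∀ᶠ z in 𝓝 x, ∀ s ∈ Metric.sphere c R, AnalyticAt ℂ G (z, s) :=
    (isCompact_sphere c R).eventually_forall_of_forall_eventually
      fun s hs => (hG s hs).eventually_analyticAt
  obtain ⟨δ, hδ, hball⟩ := Metric.eventually_nhds_iff_ball.1 h1
  refine DifferentiableOn.analyticAt (s := Metric.ball x δ) (fun z hz => ?_)
    (Metric.ball_mem_nhds x hδ)
  obtain ⟨r, hr, hrz⟩ := Metric.nhds_basis_closedBall.mem_iff.1 (Metric.isOpen_ball.mem_nhds hz)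
  have hd : ∀ w ∈ Metric.closedBall z r, ∀ θ : ℝ, AnalyticAt ℂ G (w, circleMap c R θ) :=
    fun w hw θ => hball w (hrz hw) _ (circleMap_mem_sphere c hR θ)
  -- the derivative of the integrand in the parameter
  set D : ℂ → ℝ → ℂ := fun w θ =>
    deriv (circleMap c R) θ • fderiv ℂ G (w, circleMap c R θ) (1, 0) with hD
  have hcm : Continuous fun θ : ℝ => deriv (circleMap c R) θ := by
    simp only [deriv_circleMap]
    fun_prop
  have hpair : ∀ w : ℂ, Continuous fun θ : ℝ => (w, circleMap c R θ) := fun w => by fun_prop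
  have hDcont : ContinuousOn (fun p : ℂ × ℝ => D p.1 p.2) (Metric.closedBall z r ×ˢ Set.univ) := by
    rintro ⟨w, θ⟩ ⟨hw, -⟩
    have h2 : ContinuousAt (fun p : ℂ × ℝ => fderiv ℂ G (p.1, circleMap c R p.2)) (w, θ) :=
      ContinuousAt.comp (f := fun p : ℂ × ℝ => (p.1, circleMap c R p.2)) (g := fderiv ℂ G)
        (hd w hw θ).fderiv.continuousAt (by fun_prop)
    exact ((hcm.continuousAt.comp continuousAt_snd).smul
      (h2.clm_apply continuousAt_const)).continuousWithinAt
  obtain ⟨M, hM⟩ := ((isCompact_closedBall z r).prod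
    (isCompact_uIcc (a := (0 : ℝ)) (b := 2 * Real.pi))).exists_bound_of_continuousOn
    (hDcont.mono (Set.prod_mono le_rfl (Set.subset_univ _)))
  have hcont : ∀ w ∈ Metric.closedBall z r, Continuous fun θ : ℝ =>
      deriv (circleMap c R) θ • G (w, circleMap c R θ) := fun w hw =>
    hcm.smul (continuous_iff_continuousAt.2 fun θ =>
      ContinuousAt.comp (g := G) (hd w hw θ).continuousAt (hpair w).continuousAt)
  have hzz : z ∈ Metric.closedBall z r := Metric.mem_closedBall_self hr.le
  have key := intervalIntegral.hasDerivAt_integral_of_dominated_loc_of_deriv_le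
    (μ := MeasureTheory.volume) (a := 0) (b := 2 * Real.pi)
    (F := fun w θ => deriv (circleMap c R) θ • G (w, circleMap c R θ)) (F' := D) (x₀ := z)
    (bound := fun _ => M) (s := Metric.closedBall z r) (Metric.closedBall_mem_nhds z hr)
    ((Metric.closedBall_mem_nhds z hr |> Filter.eventually_of_mem) fun w hw =>
      (hcont w hw).aestronglyMeasurable)
    ((hcont z hzz).intervalIntegrable _ _)
    (Continuous.aestronglyMeasurable (continuousOn_univ.1
      (hDcont.comp (t := Metric.closedBall z r ×ˢ Set.univ) (s := Set.univ)
        (f := fun θ : ℝ => (z, θ)) (by fun_prop) fun θ _ => ⟨hzz, trivial⟩)))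
    (Eventually.of_forall fun θ hθ w hw => hM (w, θ) ⟨hw, Set.uIoc_subset_uIcc hθ⟩)
    intervalIntegrable_const
    (Eventually.of_forall fun θ _ w hw => by
      have h2 : HasDerivAt (fun w : ℂ => (w, circleMap c R θ)) ((1 : ℂ), (0 : ℂ)) w :=
        (hasDerivAt_id w).prodMk (hasDerivAt_const w _)
      have h3 : HasDerivAt (fun w => G (w, circleMap c R θ))
          (fderiv ℂ G (w, circleMap c R θ) (1, 0)) w :=
        (hd w hw θ).differentiableAt.hasFDerivAt.comp_hasDerivAt w h2
      exact h3.const_smul (deriv (circleMap c R) θ))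
  exact key.2.differentiableAt.differentiableWithinAt

/-! ### Roots of nearby polynomials -/

lemma finite_setOf_monicFamily_eq_zero {n : ℕ} (b : Fin n → ℂ → ℂ) (x : ℂ) :
    {t | monicFamily b (x, t) = 0}.Finite := by
  set p : Polynomial ℂ := Polynomial.X ^ n +
    ∑ k : Fin n, Polynomial.C (b k x) * Polynomial.X ^ (k : ℕ) with hp
  have hpeval : ∀ t, p.eval t = monicFamily b (x, t) := fun t => by
    simp [hp, monicFamily, Polynomial.eval_finsetSum]
  have hp0 : p ≠ 0 := by
    refine (Polynomial.monic_X_pow_add ?_).ne_zero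
    refine (Polynomial.degree_sum_le _ _).trans_lt
      ((Finset.sup_lt_iff (WithBot.bot_lt_coe n)).2 fun k _ => ?_)
    exact (Polynomial.degree_C_mul_X_pow_le _ _).trans_lt (WithBot.coe_lt_coe.2 k.2)
  refine (p.roots.toFinset.finite_toSet).subset fun t ht => ?_
  simp only [Finset.mem_coe, Multiset.mem_toFinset]
  exact (Polynomial.mem_roots hp0).2 ((hpeval t).trans ht)

lemma norm_le_of_monicFamily_eq_zero {n : ℕ} {b : Fin n → ℂ → ℂ} {x t : ℂ}
    (h : monicFamily b (x, t) = 0) : ‖t‖ ≤ 1 + ∑ k, ‖b k x‖ := by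
  have hnn : 0 ≤ ∑ k, ‖b k x‖ := Finset.sum_nonneg fun _ _ => norm_nonneg _
  rcases le_or_gt ‖t‖ 1 with ht | ht
  · linarith
  · rcases n with _ | n
    · simp [monicFamily] at h
    · have h1 : t ^ (n + 1) = -∑ k : Fin (n + 1), b k x * t ^ (k : ℕ) :=
        eq_neg_of_add_eq_zero_left h
      have h2 : ‖t‖ ^ (n + 1) ≤ (∑ k, ‖b k x‖) * ‖t‖ ^ n := by
        rw [← norm_pow, h1, norm_neg, Finset.sum_mul]
        refine norm_sum_le_of_le _ fun k _ => ?_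
        rw [norm_mul, norm_pow]
        exact mul_le_mul_of_nonneg_left (pow_le_pow_right₀ ht.le (by omega)) (norm_nonneg _)
      have h3 : 0 < ‖t‖ ^ n := pow_pos (by linarith) n
      rw [pow_succ, mul_comm] at h2
      linarith [le_of_mul_le_mul_right h2 h3]

/-- Continuity of roots: an open set containing all roots of the member at `x` of a monic family
contains the roots of all nearby members. -/
lemma eventually_roots_mem {n : ℕ} {b : Fin n → ℂ → ℂ} {x : ℂ}
    (hb : ∀ k, AnalyticAt ℂ (b k) x) {O : Set ℂ} (hO : IsOpen O)
    (h : ∀ t, monicFamily b (x, t) = 0 → t ∈ O) :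
    ∀ᶠ z in 𝓝 x, ∀ t, monicFamily b (z, t) = 0 → t ∈ O := by
  set M : ℝ := 1 + (∑ k, ‖b k x‖ + 1)
  have h1 : ∀ᶠ z in 𝓝 x, ∑ k, ‖b k z‖ < ∑ k, ‖b k x‖ + 1 :=
    (tendsto_finsetSum _ fun k _ => (hb k).continuousAt.norm.tendsto).eventually_lt_const
      (lt_add_one _)
  have h2 : ∀ᶠ z in 𝓝 x, ∀ t ∈ Metric.closedBall (0 : ℂ) M \ O, monicFamily b (z, t) ≠ 0 :=
    ((isCompact_closedBall _ _).diff hO).eventually_forall_of_forall_eventually fun t ht =>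
      (analyticAt_monicFamily hb t).continuousAt.eventually_ne fun h0 => ht.2 (h t h0)
  filter_upwards [h1, h2] with z hz1 hz2 t ht
  by_contra htO
  refine hz2 t ⟨?_, htO⟩ ht
  rw [mem_closedBall_zero_iff]
  have := norm_le_of_monicFamily_eq_zero ht
  simp only [M]
  linarith

/-! ### Weierstrass division along the zero locus -/

/-- The coefficient of `t ^ i` in the divided difference `(s ^ k - t ^ k) / (s - t)`. -/
def powDivDiff (k i : ℕ) (s : ℂ) : ℂ := if i < k then s ^ (k - 1 - i) else 0

lemma sub_mul_sum_powDivDiff {n k : ℕ} (hk : k ≤ n) (s t : ℂ) :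
    (s - t) * ∑ i : Fin n, powDivDiff k i s * t ^ (i : ℕ) = s ^ k - t ^ k := by
  rw [Fin.sum_univ_eq_sum_range fun i => powDivDiff k i s * t ^ i,
    ← Finset.sum_subset (Finset.range_mono hk) fun i _ hi => by
      rw [powDivDiff, if_neg (by simpa using hi), zero_mul]]
  have h := geom_sum₂_mul t s k
  rw [Finset.sum_congr rfl fun i hi => by
    rw [powDivDiff, if_pos (Finset.mem_range.1 hi), mul_comm]]
  linear_combination -h

/-- The coefficient of `t ^ i` in the divided difference `(P (x, s) - P (x, t)) / (s - t)` of the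
monic family `P` with coefficients `b`, as a function of `(x, s)`. -/
def divDiff {n : ℕ} (b : Fin n → ℂ → ℂ) (i : Fin n) (p : ℂ × ℂ) : ℂ :=
  powDivDiff n i p.2 + ∑ k : Fin n, b k p.1 * powDivDiff k i p.2

lemma sub_mul_sum_divDiff {n : ℕ} (b : Fin n → ℂ → ℂ) (x s t : ℂ) :
    (s - t) * ∑ i : Fin n, divDiff b i (x, s) * t ^ (i : ℕ) =
      monicFamily b (x, s) - monicFamily b (x, t) := by
  have h1 : ∑ i : Fin n, divDiff b i (x, s) * t ^ (i : ℕ) =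
      ∑ i : Fin n, powDivDiff n i s * t ^ (i : ℕ) +
        ∑ k : Fin n, b k x * ∑ i : Fin n, powDivDiff k i s * t ^ (i : ℕ) := by
    simp only [divDiff, add_mul, Finset.sum_add_distrib, Finset.sum_mul, Finset.mul_sum]
    rw [Finset.sum_comm]
    simp only [mul_assoc]
  rw [h1, mul_add, sub_mul_sum_powDivDiff le_rfl, Finset.mul_sum]
  simp only [mul_left_comm (s - t), sub_mul_sum_powDivDiff (Fin.is_le' : _ ≤ n), monicFamily,
    mul_sub, Finset.sum_sub_distrib]
  ring

lemma analyticAt_divDiff {n : ℕ} {b : Fin n → ℂ → ℂ} {x : ℂ}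
    (hb : ∀ k, AnalyticAt ℂ (b k) x) (i : Fin n) (s : ℂ) :
    AnalyticAt ℂ (divDiff b i) (x, s) := by
  have h : ∀ k, AnalyticAt ℂ (fun p : ℂ × ℂ => powDivDiff k i p.2) (x, s) := fun k => by
    unfold powDivDiff
    split_ifs
    · exact analyticAt_snd.pow _
    · exact analyticAt_const
  refine (h n).add (Finset.analyticAt_fun_sum _ fun k _ => ?_)
  exact (AnalyticAt.fun_comp (f := Prod.fst) (hb k) analyticAt_fst).mul (h k)

/-- A function that near each point of the fibre over `x` of the zero locus of a monic family is
the restriction of a holomorphic function agrees on the zero locus over a neighbourhood of `x`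
with a polynomial of degree `< n` whose coefficients are holomorphic. They are given by Cauchy
integrals of the divided difference over small circles around the roots at `x`. -/
theorem exists_analyticAt_coeff {n : ℕ} {b : Fin n → ℂ → ℂ} {x : ℂ}
    (hb : ∀ k, AnalyticAt ℂ (b k) x) {f : ℂ × ℂ → ℂ}
    (hf : ∀ t, monicFamily b (x, t) = 0 → ∃ F : ℂ × ℂ → ℂ, AnalyticAt ℂ F (x, t) ∧
      ∀ᶠ p in 𝓝 (x, t), monicFamily b p = 0 → f p = F p) :
    ∃ c : Fin n → ℂ → ℂ, (∀ k, AnalyticAt ℂ (c k) x) ∧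
      ∀ᶠ z in 𝓝 x, ∀ t, monicFamily b (z, t) = 0 → f (z, t) = ∑ k : Fin n, c k z * t ^ (k : ℕ) := by
  classical
  choose! F hFa hFf using hf
  set Z := (finite_setOf_monicFamily_eq_zero b x).toFinset with hZdef
  have hZ : ∀ t, t ∈ Z ↔ monicFamily b (x, t) = 0 := fun t => by simp [hZdef]
  -- a common radius for disjoint discs on which the local extensions are defined
  obtain ⟨ε, hε, hεF, hεd⟩ : ∃ ε : ℝ, 0 < ε ∧
      (∀ t ∈ Z, ∀ s ∈ Metric.closedBall t ε, ∀ᶠ p in 𝓝 (x, s),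
        AnalyticAt ℂ (F t) p ∧ (monicFamily b p = 0 → f p = F t p)) ∧
      ∀ t ∈ Z, ∀ t' ∈ Z, dist t t' ≤ 2 * ε → t = t' := by
    have h1 : ∀ t ∈ Z, ∀ᶠ ε in 𝓝[>] (0 : ℝ), ∀ s ∈ Metric.closedBall t ε, ∀ᶠ p in 𝓝 (x, s),
        AnalyticAt ℂ (F t) p ∧ (monicFamily b p = 0 → f p = F t p) := fun t ht => by
      have h2 := ((hFa t ((hZ t).1 ht)).eventually_analyticAt.and
        (hFf t ((hZ t).1 ht))).eventually_nhds
      have h3 := ((Continuous.prodMk_right x).tendsto t).eventually h2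
      obtain ⟨r, hr, hrt⟩ := Metric.eventually_nhds_iff_ball.1 h3
      filter_upwards [Ioo_mem_nhdsGT hr] with ε hε s hs
      exact hrt s (Metric.closedBall_subset_ball hε.2 hs)
    have h2 : ∀ t ∈ Z, ∀ t' ∈ Z, ∀ᶠ ε in 𝓝[>] (0 : ℝ), dist t t' ≤ 2 * ε → t = t' := by
      intro t _ t' _
      by_cases h : t = t'
      · exact Eventually.of_forall fun _ _ => h
      · filter_upwards [Ioo_mem_nhdsGT (half_pos (dist_pos.2 h))] with ε hε hle
        linarith [hε.2]
    have h3 := ((Filter.eventually_all_finset Z).2 h1).and ((Filter.eventually_all_finset Z).2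
      fun t ht => (Filter.eventually_all_finset Z).2 (h2 t ht))
    obtain ⟨ε, ⟨h4, h5⟩, h6⟩ := (h3.and self_mem_nhdsWithin).exists
    exact ⟨ε, h6, h4, h5⟩
  -- the circles around the roots carry no roots
  have hsphere : ∀ t ∈ Z, ∀ s ∈ Metric.sphere t ε, monicFamily b (x, s) ≠ 0 := by
    intro t ht s hs h0
    rw [Metric.mem_sphere] at hs
    have := hεd s ((hZ s).2 h0) t ht (by linarith)
    rw [this, dist_self] at hs
    exact hε.ne hs
  set G : ℂ → Fin n → ℂ × ℂ → ℂ := fun t i p => F t p / monicFamily b p * divDiff b i p with hG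
  have hGa : ∀ t ∈ Z, ∀ i, ∀ s ∈ Metric.sphere t ε, AnalyticAt ℂ (G t i) (x, s) := by
    intro t ht i s hs
    exact ((hεF t ht s (Metric.sphere_subset_closedBall hs)).self_of_nhds.1.div
      (analyticAt_monicFamily hb s) (hsphere t ht s hs)).mul (analyticAt_divDiff hb i s)
  refine ⟨fun i z => ∑ t ∈ Z, (2 * Real.pi * Complex.I)⁻¹ * ∮ s in C(t, ε), G t i (z, s),
    fun i => Finset.analyticAt_fun_sum _ fun t ht =>
      analyticAt_const.mul (analyticAt_circleIntegral hε.le (hGa t ht i)), ?_⟩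
  have hev1 : ∀ᶠ z in 𝓝 x, ∀ τ, monicFamily b (z, τ) = 0 → τ ∈ ⋃ t ∈ Z, Metric.ball t ε := by
    refine eventually_roots_mem hb (isOpen_biUnion fun _ _ => Metric.isOpen_ball) fun τ hτ => ?_
    exact Set.mem_biUnion ((hZ τ).2 hτ) (Metric.mem_ball_self hε)
  have hev2 : ∀ᶠ z in 𝓝 x, ∀ t ∈ Z, ∀ s ∈ Metric.closedBall t ε,
      AnalyticAt ℂ (F t) (z, s) ∧ (monicFamily b (z, s) = 0 → f (z, s) = F t (z, s)) :=
    (Filter.eventually_all_finset Z).2 fun t ht =>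
      (isCompact_closedBall t ε).eventually_forall_of_forall_eventually fun s hs => hεF t ht s hs
  have hev3 : ∀ᶠ z in 𝓝 x, ∀ t ∈ Z, ∀ s ∈ Metric.sphere t ε, monicFamily b (z, s) ≠ 0 :=
    (Filter.eventually_all_finset Z).2 fun t ht =>
      (isCompact_sphere t ε).eventually_forall_of_forall_eventually fun s hs =>
        (analyticAt_monicFamily hb s).continuousAt.eventually_ne (hsphere t ht s hs)
  have hev4 : ∀ᶠ z in 𝓝 x, ∀ t ∈ Z, ∀ i, ∀ s ∈ Metric.sphere t ε, AnalyticAt ℂ (G t i) (z, s) :=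
    (Filter.eventually_all_finset Z).2 fun t ht => Filter.eventually_all.2 fun i =>
      (isCompact_sphere t ε).eventually_forall_of_forall_eventually fun s hs =>
        (hGa t ht i s hs).eventually_analyticAt
  filter_upwards [hev1, hev2, hev3, hev4] with z h1 h2 h3 h4 τ hτ
  obtain ⟨t₀, ht₀, hτt⟩ := Set.mem_iUnion₂.1 (h1 τ hτ)
  have hslice : ∀ s : ℂ, AnalyticAt ℂ (fun s : ℂ => (z, s)) s :=
    fun s => analyticAt_const.prod analyticAt_id
  -- along the circles the integrand is the Cauchy kernel times the local extension
  have hker : ∀ t ∈ Z, ∑ i : Fin n, (∮ s in C(t, ε), G t i (z, s)) * τ ^ (i : ℕ) =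
      ∮ s in C(t, ε), (s - τ)⁻¹ • F t (z, s) := by
    intro t ht
    have hint : ∀ i : Fin n, CircleIntegrable (fun s => τ ^ (i : ℕ) • G t i (z, s)) t ε := fun i =>
      ContinuousOn.circleIntegrable hε.le fun s hs =>
        ((AnalyticAt.fun_comp (f := fun s : ℂ => (z, s)) (h4 t ht i s hs)
          (hslice s)).continuousAt.fun_const_smul _).continuousWithinAt
    have hsum : ∑ i : Fin n, (∮ s in C(t, ε), G t i (z, s)) * τ ^ (i : ℕ) =
        ∮ s in C(t, ε), ∑ i : Fin n, τ ^ (i : ℕ) • G t i (z, s) := by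
      rw [circleIntegral.integral_fun_sum fun i _ => hint i]
      refine Finset.sum_congr rfl fun i _ => ?_
      rw [circleIntegral.integral_smul, smul_eq_mul, mul_comm]
    rw [hsum]
    refine circleIntegral.integral_congr hε.le fun s hs => ?_
    have hP := h3 t ht s hs
    have hsτ : s - τ ≠ 0 := fun h0 => hP (by rwa [sub_eq_zero.1 h0])
    have hdd := sub_mul_sum_divDiff b z s τ
    rw [hτ, sub_zero] at hdd
    have : ∑ i : Fin n, τ ^ (i : ℕ) • G t i (z, s) =
        F t (z, s) / monicFamily b (z, s) *
          ∑ i : Fin n, divDiff b i (z, s) * τ ^ (i : ℕ) := by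
      rw [Finset.mul_sum]
      refine Finset.sum_congr rfl fun i _ => ?_
      simp only [hG, smul_eq_mul]
      ring
    rw [this, smul_eq_mul, eq_inv_mul_iff_mul_eq₀ hsτ, mul_left_comm, hdd, div_mul_cancel₀ _ hP]
  have hFd : ∀ t ∈ Z, DifferentiableOn ℂ (fun s => F t (z, s)) (Metric.closedBall t ε) :=
    fun t ht s hs => (AnalyticAt.fun_comp (f := fun s : ℂ => (z, s)) (h2 t ht s hs).1
      (hslice s)).differentiableAt.differentiableWithinAt
  have hval : ∀ t ∈ Z, t ≠ t₀ → ∮ s in C(t, ε), (s - τ)⁻¹ • F t (z, s) = 0 := by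
    intro t ht htt
    refine DiffContOnCl.circleIntegral_eq_zero hε.le (DifferentiableOn.diffContOnCl_ball
      (U := Metric.closedBall t ε) ?_ le_rfl)
    refine DifferentiableOn.fun_smul (DifferentiableOn.fun_inv (by fun_prop) fun s hs h0 => ?_)
      (hFd t ht)
    rw [sub_eq_zero.1 h0] at hs
    refine htt (hεd t ht t₀ ht₀ ?_)
    rw [Metric.mem_closedBall] at hs
    rw [Metric.mem_ball] at hτt
    linarith [dist_triangle_left t t₀ τ]
  have hmain : ∑ i : Fin n, (∑ t ∈ Z, (2 * Real.pi * Complex.I)⁻¹ * ∮ s in C(t, ε), G t i (z, s)) *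
      τ ^ (i : ℕ) = ∑ t ∈ Z, (2 * Real.pi * Complex.I)⁻¹ *
        ∮ s in C(t, ε), (s - τ)⁻¹ • F t (z, s) := by
    simp only [Finset.sum_mul]
    rw [Finset.sum_comm]
    refine Finset.sum_congr rfl fun t ht => ?_
    rw [← hker t ht, Finset.mul_sum]
    simp only [mul_assoc]
  rw [hmain, Finset.sum_eq_single t₀ (fun t ht htt => by rw [hval t ht htt, mul_zero])
    fun h => absurd ht₀ h, (hFd t₀ ht₀).circleIntegral_sub_inv_smul hτt, smul_eq_mul,
    inv_mul_cancel_left₀ Complex.two_pi_I_ne_zero]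
  exact (h2 t₀ ht₀ τ (Metric.ball_subset_closedBall hτt)).2 hτ

/-! ### Tensor powers of a line in a trivialization -/

section Fibre

variable {X : Type*} [TopologicalSpace X] {L : X → Type*} [∀ x, AddCommGroup (L x)]
  [∀ x, Module ℂ (L x)] [∀ x, TopologicalSpace (L x)] [TopologicalSpace (TotalSpace ℂ L)]
  [FiberBundle ℂ L] [VectorBundle ℂ ℂ L] (e : Trivialization ℂ (π ℂ L)) [MemTrivializationAtlas e]

lemma powCoord_tprod (k : ℕ) (x : X) (v : Fin k → L x) :
    powCoord e k x (PiTensorProduct.tprod ℂ v) = ∏ i, e.linearMapAt ℂ x (v i) := by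
  simp [powCoord]

lemma linearMapAt_snd {y : TotalSpace ℂ L} (hy : y.proj ∈ e.baseSet) :
    e.linearMapAt ℂ y.proj y.2 = (e y).2 := by
  rw [Trivialization.linearMapAt_apply, if_pos hy]

lemma linearMapAt_frame {x : X} (hx : x ∈ e.baseSet) : e.linearMapAt ℂ x (frame e x) = 1 := by
  rw [frame, ← Trivialization.symmₗ_apply (R := ℂ) e hx, Trivialization.linearMapAt_symmₗ e hx]

lemma eq_linearMapAt_smul_frame {x : X} (hx : x ∈ e.baseSet) (v : L x) :
    v = e.linearMapAt ℂ x v • frame e x := by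
  have h := snd_eq_smul_frame e ⟨x, v⟩ hx
  rwa [← linearMapAt_snd e (y := ⟨x, v⟩) hx] at h

/-- A tensor power of the line `L x` is spanned by the corresponding power of the frame. -/
lemma eq_powCoord_smul_frame (k : ℕ) {x : X} (hx : x ∈ e.baseSet) (T : ⨂[ℂ]^k (L x)) :
    T = powCoord e k x T • PiTensorProduct.tprod ℂ fun _ : Fin k => frame e x := by
  induction T using PiTensorProduct.induction_on with
  | smul_tprod r v =>
    rw [map_smul, powCoord_tprod, smul_assoc, ← MultilinearMap.map_smul_univ]
    congr 2
    funext i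
    exact eq_linearMapAt_smul_frame e hx (v i)
  | add A B hA hB =>
    rw [map_add, add_smul, ← hA, ← hB]

lemma powCoord_eq_zero_iff (k : ℕ) {x : X} (hx : x ∈ e.baseSet) (T : ⨂[ℂ]^k (L x)) :
    powCoord e k x T = 0 ↔ T = 0 := by
  refine ⟨fun h => ?_, fun h => by rw [h, map_zero]⟩
  rw [eq_powCoord_smul_frame e k hx T, h, zero_smul]

lemma powCoord_cast {i j : ℕ} (h : i = j) (x : X) (T : ⨂[ℂ]^i (L x)) :
    powCoord e j x (TensorPower.cast ℂ (L x) h T) = powCoord e i x T := by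
  subst h
  simp

lemma powCoord_mulEquiv {i j : ℕ} {x : X} (hx : x ∈ e.baseSet) (A : ⨂[ℂ]^i (L x))
    (B : ⨂[ℂ]^j (L x)) :
    powCoord e (i + j) x (TensorPower.mulEquiv (A ⊗ₜ[ℂ] B)) =
      powCoord e i x A * powCoord e j x B := by
  have h : TensorPower.mulEquiv ((PiTensorProduct.tprod ℂ fun _ : Fin i => frame e x) ⊗ₜ[ℂ]
      PiTensorProduct.tprod ℂ fun _ : Fin j => frame e x) =
      PiTensorProduct.tprod ℂ (Fin.append (fun _ : Fin i => frame e x)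
        fun _ : Fin j => frame e x) :=
    TensorPower.tprod_mul_tprod ℂ _ _
  conv_lhs => rw [eq_powCoord_smul_frame e i hx A, eq_powCoord_smul_frame e j hx B]
  rw [TensorProduct.smul_tmul_smul, map_smul, map_smul, h, powCoord_tprod, Fin.prod_univ_add]
  simp [linearMapAt_frame e hx]

lemma powCoord_tautPow (k : ℕ) {y : TotalSpace ℂ L} (hy : y.proj ∈ e.baseSet) :
    powCoord e k y.proj (tautPow L k y) = (e y).2 ^ k := by
  rw [tautPow, powCoord_tprod]
  simp only [linearMapAt_snd e hy, Finset.prod_const, Finset.card_univ, Fintype.card_fin]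

lemma negPow_apply (k : ℕ) {x : X} (hx : x ∈ e.baseSet) (c : NegPow L k x) (T : ⨂[ℂ]^k (L x)) :
    c T = c (PiTensorProduct.tprod ℂ fun _ : Fin k => frame e x) * powCoord e k x T := by
  conv_lhs => rw [eq_powCoord_smul_frame e k hx T]
  rw [map_smul, smul_eq_mul, mul_comm]

lemma negPow_tautPow (k : ℕ) {y : TotalSpace ℂ L} (hy : y.proj ∈ e.baseSet)
    (c : NegPow L k y.proj) :
    c (tautPow L k y) =
      c (PiTensorProduct.tprod ℂ fun _ : Fin k => frame e y.proj) * (e y).2 ^ k := by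
  rw [negPow_apply e k hy, powCoord_tautPow e k hy]

variable {n : ℕ} (a : (j : Fin n) → (x : X) → ⨂[ℂ]^((j : ℕ) + 1) (L x))

/-- The coefficient of `t ^ k` in the polynomial that `p(λ)` becomes in the trivialization `e`. -/
noncomputable def polyCoeff (k : Fin n) (x : X) : ℂ := powCoord e ((k.rev : ℕ) + 1) x (a k.rev x)

lemma powCoord_poly {y : TotalSpace ℂ L} (hy : y.proj ∈ e.baseSet) :
    powCoord e n y.proj (poly a y) =
      (e y).2 ^ n + ∑ k : Fin n, polyCoeff e a k y.proj * (e y).2 ^ (k : ℕ) := by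
  rw [poly, map_add, powCoord_tautPow e n hy, map_sum, ← Equiv.sum_comp Fin.revPerm]
  congr 1
  refine Finset.sum_congr rfl fun k _ => ?_
  rw [powCoord_cast, powCoord_mulEquiv e hy, powCoord_tautPow e _ hy]
  congr 2
  simp only [Fin.revPerm_apply, Fin.val_rev]
  omega

end Fibre

/-! ### Coordinates on the total space -/

section Coordinates

variable {X : Type*} [TopologicalSpace X] [ChartedSpace ℂ X] {L : X → Type*}
  [TopologicalSpace (TotalSpace ℂ L)]
  (e : Trivialization ℂ (π ℂ L)) (x₀ : X)

/-- The coordinates on `Tot(L)` given by the chart of `X` at `x₀` and the trivialization `e`. -/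
noncomputable def totCoord (y : TotalSpace ℂ L) : ℂ × ℂ := (chartAt ℂ x₀ y.proj, (e y).2)

/-- The point of `Tot(L)` with coordinates `p`, inverse to `totCoord`. -/
noncomputable def totPoint (p : ℂ × ℂ) : TotalSpace ℂ L :=
  e.toOpenPartialHomeomorph.symm ((chartAt ℂ x₀).symm p.1, p.2)

variable {e x₀}

lemma proj_totPoint {p : ℂ × ℂ} (hp : (chartAt ℂ x₀).symm p.1 ∈ e.baseSet) :
    (totPoint e x₀ p).proj = (chartAt ℂ x₀).symm p.1 :=
  e.proj_symm_apply (e.mem_target.2 hp)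

lemma snd_totPoint {p : ℂ × ℂ} (hp : (chartAt ℂ x₀).symm p.1 ∈ e.baseSet) :
    (e (totPoint e x₀ p)).2 = p.2 := by
  rw [totPoint, e.apply_symm_apply (e.mem_target.2 hp)]

lemma totPoint_totCoord {y : TotalSpace ℂ L} (hy : y.proj ∈ e.baseSet)
    (hy' : y.proj ∈ (chartAt ℂ x₀).source) : totPoint e x₀ (totCoord e x₀ y) = y := by
  rw [totPoint, totCoord, (chartAt ℂ x₀).left_inv hy']
  have h : (y.proj, (e y).2) = e y := Prod.ext (e.coe_fst' hy).symm rfl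
  rw [h]
  exact e.left_inv (e.mem_source.2 hy)

variable [∀ x, AddCommGroup (L x)] [∀ x, Module ℂ (L x)] [∀ x, TopologicalSpace (L x)]
  [FiberBundle ℂ L] [VectorBundle ℂ ℂ L] [MemTrivializationAtlas e] {n : ℕ}
  {a : (j : Fin n) → (x : X) → ⨂[ℂ]^((j : ℕ) + 1) (L x)}

lemma mem_curve_iff {y : TotalSpace ℂ L} (hy : y.proj ∈ e.baseSet)
    (hy' : y.proj ∈ (chartAt ℂ x₀).source) :
    y ∈ curve a ↔
      monicFamily (fun k => polyCoeff e a k ∘ (chartAt ℂ x₀).symm) (totCoord e x₀ y) = 0 := by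
  rw [curve, Set.mem_ofPred_eq, ← powCoord_eq_zero_iff e n hy, powCoord_poly e a hy]
  simp only [monicFamily, totCoord, Function.comp_apply, (chartAt ℂ x₀).left_inv hy']

lemma totPoint_mem_curve_iff {p : ℂ × ℂ} (hp : (chartAt ℂ x₀).symm p.1 ∈ e.baseSet) :
    totPoint e x₀ p ∈ curve a ↔
      monicFamily (fun k => polyCoeff e a k ∘ (chartAt ℂ x₀).symm) p = 0 := by
  have hb : (totPoint e x₀ p).proj ∈ e.baseSet := by rwa [proj_totPoint hp]
  rw [curve, Set.mem_ofPred_eq, ← powCoord_eq_zero_iff e n hb, powCoord_poly e a hb,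
    snd_totPoint hp, proj_totPoint hp]
  rfl

variable [IsManifold 𝓘(ℂ) ω X]

lemma analyticAt_comp_chartAt_symm {g : X → ℂ} (hg : ContMDiffAt 𝓘(ℂ) 𝓘(ℂ) ω g x₀) :
    AnalyticAt ℂ (g ∘ (chartAt ℂ x₀).symm) (chartAt ℂ x₀ x₀) := by
  refine ContDiffAt.analyticAt (contMDiffAt_iff_contDiffAt.1 ?_)
  refine ContMDiffAt.comp (I' := 𝓘(ℂ)) _ ?_
    ((contMDiffOn_chart_symm (I := 𝓘(ℂ)) (x := x₀)).contMDiffAt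
      ((chartAt ℂ x₀).open_target.mem_nhds (mem_chart_target ℂ x₀)))
  rwa [(chartAt ℂ x₀).left_inv (mem_chart_source ℂ x₀)]

lemma contMDiffAt_comp_chartAt {h : ℂ → ℂ} {x : X} (hx : x ∈ (chartAt ℂ x₀).source)
    (hh : AnalyticAt ℂ h (chartAt ℂ x₀ x)) :
    ContMDiffAt 𝓘(ℂ) 𝓘(ℂ) ω (fun x => h (chartAt ℂ x₀ x)) x :=
  ContMDiffAt.comp (I' := 𝓘(ℂ)) (g := h) x (contMDiffAt_iff_contDiffAt.2 hh.contDiffAt)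
    ((contMDiffOn_chart (I := 𝓘(ℂ)) (x := x₀)).contMDiffAt
      ((chartAt ℂ x₀).open_source.mem_nhds hx))

lemma analyticAt_polyCoeff (ha : ∀ j : Fin n, IsHolSection L ((j : ℕ) + 1) (a j))
    (hx : x₀ ∈ e.baseSet) (k : Fin n) :
    AnalyticAt ℂ (polyCoeff e a k ∘ (chartAt ℂ x₀).symm) (chartAt ℂ x₀ x₀) :=
  analyticAt_comp_chartAt_symm ((ha k.rev e).contMDiffAt (e.open_baseSet.mem_nhds hx))

variable [ContMDiffVectorBundle ω ℂ L 𝓘(ℂ)]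

lemma contMDiffAt_totPoint {p : ℂ × ℂ} (hp : (chartAt ℂ x₀).symm p.1 ∈ e.baseSet)
    (hp' : p.1 ∈ (chartAt ℂ x₀).target) :
    ContMDiffAt 𝓘(ℂ, ℂ × ℂ) (𝓘(ℂ).prod 𝓘(ℂ)) ω (totPoint e x₀) p := by
  have h1 : ContMDiffAt (𝓘(ℂ).prod 𝓘(ℂ)) (𝓘(ℂ).prod 𝓘(ℂ)) ω e.toOpenPartialHomeomorph.symm
      ((chartAt ℂ x₀).symm p.1, p.2) :=
    (e.contMDiffOn_symm (IB := 𝓘(ℂ))).contMDiffAt (e.open_target.mem_nhds (e.mem_target.2 hp))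
  refine ContMDiffAt.comp (I' := 𝓘(ℂ).prod 𝓘(ℂ)) p h1 (ContMDiffAt.prodMk ?_ ?_)
  · exact ContMDiffAt.comp (I' := 𝓘(ℂ)) p
      ((contMDiffOn_chart_symm (I := 𝓘(ℂ)) (x := x₀)).contMDiffAt
      ((chartAt ℂ x₀).open_target.mem_nhds hp'))
      (contMDiffAt_iff_contDiffAt.2 contDiffAt_fst)
  · exact contMDiffAt_iff_contDiffAt.2 contDiffAt_snd

lemma contMDiffAt_totCoord {y : TotalSpace ℂ L} (hy : y.proj ∈ e.baseSet)
    (hy' : y.proj ∈ (chartAt ℂ x₀).source) :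
    ContMDiffAt (𝓘(ℂ).prod 𝓘(ℂ)) 𝓘(ℂ, ℂ × ℂ) ω (totCoord e x₀) y := by
  refine ContMDiffAt.prodMk_space ?_ ?_
  · exact ContMDiffAt.comp (I' := 𝓘(ℂ)) y ((contMDiffOn_chart (I := 𝓘(ℂ)) (x := x₀)).contMDiffAt
      ((chartAt ℂ x₀).open_source.mem_nhds hy')) (contMDiff_proj L).contMDiffAt
  · exact contMDiffAt_snd.comp y ((e.contMDiffOn (IB := 𝓘(ℂ)) (n := ω)).contMDiffAt
      (e.open_source.mem_nhds (e.mem_source.2 hy)))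

/-- Smoothness of the divisor of `p(λ)`, read in coordinates. -/
lemma fderiv_monicFamily_ne_zero (ha : ∀ j : Fin n, IsHolSection L ((j : ℕ) + 1) (a j))
    (hS : IsSmoothCurve a) (hx : x₀ ∈ e.baseSet) (t : ℂ)
    (ht : monicFamily (fun k => polyCoeff e a k ∘ (chartAt ℂ x₀).symm) (chartAt ℂ x₀ x₀, t) = 0) :
    fderiv ℂ (monicFamily fun k => polyCoeff e a k ∘ (chartAt ℂ x₀).symm)
      (chartAt ℂ x₀ x₀, t) ≠ 0 := by
  intro h0
  set P := monicFamily fun k => polyCoeff e a k ∘ (chartAt ℂ x₀).symm with hP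
  have hx' : (chartAt ℂ x₀).symm (chartAt ℂ x₀ x₀) = x₀ :=
    (chartAt ℂ x₀).left_inv (mem_chart_source ℂ x₀)
  have hp : (chartAt ℂ x₀).symm (chartAt ℂ x₀ x₀, t).1 ∈ e.baseSet := by rwa [hx']
  set y := totPoint e x₀ (chartAt ℂ x₀ x₀, t) with hy
  have hyproj : y.proj = x₀ := (proj_totPoint hp).trans hx'
  have hyc : totCoord e x₀ y = (chartAt ℂ x₀ x₀, t) :=
    Prod.ext (congrArg (chartAt ℂ x₀) hyproj) (snd_totPoint hp)
  have hyb : y.proj ∈ e.baseSet := by rwa [hyproj]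
  have hys : y.proj ∈ (chartAt ℂ x₀).source := by rw [hyproj]; exact mem_chart_source ℂ x₀
  refine hS y ((totPoint_mem_curve_iff hp).2 ht) e hyb ?_
  have heq : (fun z => powCoord e n z.proj (poly a z)) =ᶠ[𝓝 y] P ∘ totCoord e x₀ := by
    filter_upwards [((e.open_baseSet.inter (chartAt ℂ x₀).open_source).preimage
      (FiberBundle.continuous_proj ℂ L)).mem_nhds ⟨hyb, hys⟩] with z hz
    rw [powCoord_poly e a hz.1]
    simp only [hP, monicFamily, totCoord, Function.comp_apply, (chartAt ℂ x₀).left_inv hz.2]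
  have hPd : MDifferentiableAt 𝓘(ℂ, ℂ × ℂ) 𝓘(ℂ) P (totCoord e x₀ y) := by
    rw [hyc]
    exact (analyticAt_monicFamily (analyticAt_polyCoeff ha hx) t).differentiableAt.mdifferentiableAt
  rw [heq.mfderiv_eq, mfderiv_comp y hPd
    ((contMDiffAt_totCoord hyb hys).mdifferentiableAt (by simp)), mfderiv_eq_fderiv, hyc, h0]
  exact ContinuousLinearMap.zero_comp _

end Coordinates

section Sheaf

variable {X : Type*} [TopologicalSpace X] [ChartedSpace ℂ X]
  {L : X → Type*} [∀ x, AddCommGroup (L x)] [∀ x, Module ℂ (L x)]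
  [∀ x, TopologicalSpace (L x)] [TopologicalSpace (TotalSpace ℂ L)]
  [FiberBundle ℂ L] [VectorBundle ℂ ℂ L] [ContMDiffVectorBundle ω ℂ L 𝓘(ℂ)]

/-! ### Restriction and change of trivialization -/

/-- A function on an open set is holomorphic near points where it restricts to a holomorphic
function on a smaller open set. -/
lemma contMDiffAt_of_restrict {U V : Opens X} (h : V ≤ U) {f : U → ℂ} {x : V}
    (hf : ContMDiffAt 𝓘(ℂ) 𝓘(ℂ) ω (fun z : V => f ⟨z, h z.2⟩) x) :
    ContMDiffAt 𝓘(ℂ) 𝓘(ℂ) ω f ⟨x, h x.2⟩ := by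
  set F : X → ℂ := Function.extend (Subtype.val : U → X) f 0
  have hF : ∀ z : U, F z = f z := fun z => Subtype.val_injective.extend_apply f 0 z
  have h1 : (fun z : V => f ⟨z, h z.2⟩) = fun z : V => F z := funext fun z => (hF ⟨z, h z.2⟩).symm
  have h2 : f = fun z : U => F z := funext fun z => (hF z).symm
  rw [h1] at hf
  have h3 : ContMDiffAt 𝓘(ℂ) 𝓘(ℂ) ω F x := contMDiffAt_subtype_iff.1 hf
  rw [h2]
  exact (contMDiffAt_subtype_iff (x := (⟨x, h x.2⟩ : U))).2 h3

/-- The transition functions between two trivializations of `L` are holomorphic. -/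
lemma contMDiffAt_linearMapAt_frame (e e' : Trivialization ℂ (π ℂ L)) [MemTrivializationAtlas e]
    [MemTrivializationAtlas e'] {x : X} (hx : x ∈ e.baseSet) (hx' : x ∈ e'.baseSet) :
    ContMDiffAt 𝓘(ℂ) 𝓘(ℂ) ω (fun z => e.linearMapAt ℂ z (frame e' z)) x := by
  have h1 : ContMDiffAt 𝓘(ℂ) (𝓘(ℂ).prod 𝓘(ℂ)) ω
      (fun z => e'.toOpenPartialHomeomorph.symm (z, (1 : ℂ))) x :=
    ContMDiffAt.comp (I' := 𝓘(ℂ).prod 𝓘(ℂ)) x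
      ((e'.contMDiffOn_symm (IB := 𝓘(ℂ))).contMDiffAt
        (e'.open_target.mem_nhds (e'.mem_target.2 hx')))
      (contMDiffAt_id.prodMk contMDiffAt_const)
  have hp : (e'.toOpenPartialHomeomorph.symm (x, (1 : ℂ))).proj = x :=
    e'.proj_symm_apply (e'.mem_target.2 hx')
  have h2 : ContMDiffAt 𝓘(ℂ) 𝓘(ℂ) ω
      (fun z => (e (e'.toOpenPartialHomeomorph.symm (z, (1 : ℂ)))).2) x := by
    refine contMDiffAt_snd.comp x (ContMDiffAt.comp (I' := 𝓘(ℂ).prod 𝓘(ℂ)) x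
      ((e.contMDiffOn (IB := 𝓘(ℂ)) (n := ω)).contMDiffAt
        (e.open_source.mem_nhds (e.mem_source.2 ?_))) h1)
    rwa [hp]
  refine h2.congr_of_eventuallyEq ?_
  filter_upwards [(e.open_baseSet.inter e'.open_baseSet).mem_nhds ⟨hx, hx'⟩] with z hz
  rw [← e'.mk_symm hz.2]
  exact linearMapAt_snd e (y := ⟨z, frame e' z⟩) hz.1

variable [IsManifold 𝓘(ℂ) ω X] {n : ℕ}
  {a : (j : Fin n) → (x : X) → ⨂[ℂ]^((j : ℕ) + 1) (L x)}

/-! ### Injectivity -/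

/-- In coordinates this is `coeff_eq_zero_of_smooth`; it is the only place where smoothness of the
divisor enters. -/
theorem sumMap_injective (ha : ∀ j : Fin n, IsHolSection L ((j : ℕ) + 1) (a j))
    (hS : IsSmoothCurve a) (U : Opens X) : Function.Injective (sumMap a U) := by
  refine (injective_iff_map_eq_zero (sumMap a U)).2 fun c hc => ?_
  have hc' : ∀ w : preim (curve a) U, ∑ i : Fin n, (c i).1 (projOn (curve a) U w)
      (tautPow L i ((w : curve a) : TotalSpace ℂ L)) = 0 :=
    fun w => congrFun (congrArg Subtype.val hc) w
  funext i
  refine Subtype.ext (funext fun x₀ => LinearMap.ext fun T => ?_)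
  set e := trivializationAt ℂ L (x₀ : X)
  have hx₀ : (x₀ : X) ∈ e.baseSet := FiberBundle.mem_baseSet_trivializationAt' _
  set φ := chartAt ℂ (x₀ : X)
  set g : Fin n → X → ℂ := fun k => Function.extend (Subtype.val : U → X)
    (fun x : U => (c k).1 x (PiTensorProduct.tprod ℂ fun _ : Fin k => frame e (x : X))) 0 with hg
  have hgx : ∀ k (x : U), g k x =
      (c k).1 x (PiTensorProduct.tprod ℂ fun _ : Fin k => frame e (x : X)) := fun k x =>
    Subtype.val_injective.extend_apply (fun x : U => (c k).1 x
      (PiTensorProduct.tprod ℂ fun _ : Fin k => frame e (x : X))) 0 x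
  have hga : ∀ k, AnalyticAt ℂ (g k ∘ φ.symm) (φ x₀) := fun k =>
    analyticAt_comp_chartAt_symm ((contMDiffOn_extend ((c k).2 e) e.open_baseSet).contMDiffAt
      ((e.open_baseSet.inter U.2).mem_nhds ⟨hx₀, x₀.2⟩))
  have hφ : φ.symm (φ x₀) = x₀ := φ.left_inv (mem_chart_source ℂ (x₀ : X))
  have hnear : ∀ᶠ z in 𝓝 (φ x₀), φ.symm z ∈ e.baseSet ∩ U :=
    (φ.continuousAt_symm (mem_chart_target ℂ (x₀ : X))).eventually_mem
      ((e.open_baseSet.inter U.2).mem_nhds (by rw [hφ]; exact ⟨hx₀, x₀.2⟩))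
  have key := coeff_eq_zero_of_smooth (analyticAt_polyCoeff ha hx₀) hga
    (fderiv_monicFamily_ne_zero ha hS hx₀) (by
      filter_upwards [hnear] with z hz t ht
      have hproj : (totPoint e (x₀ : X) (z, t)).proj = φ.symm z := proj_totPoint hz.1
      have hw := hc' ⟨⟨totPoint e (x₀ : X) (z, t), (totPoint_mem_curve_iff hz.1).2 ht⟩,
        show (totPoint e (x₀ : X) (z, t)).proj ∈ U by rw [hproj]; exact hz.2⟩
      have hb : (totPoint e (x₀ : X) (z, t)).proj ∈ e.baseSet := by rw [hproj]; exact hz.1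
      have hU : (totPoint e (x₀ : X) (z, t)).proj ∈ U := by rw [hproj]; exact hz.2
      refine Eq.trans (Finset.sum_congr rfl fun k _ => ?_) hw
      refine Eq.trans ?_ (negPow_tautPow e k hb ((c k).1 ⟨_, hU⟩)).symm
      rw [snd_totPoint hz.1, Function.comp_apply, ← hproj]
      exact congrArg (· * t ^ (k : ℕ)) (hgx k ⟨_, hU⟩)) i
  rw [Function.comp_apply, hφ, hgx] at key
  rw [negPow_apply e i hx₀, key, zero_mul]
  rfl

/-! ### Local surjectivity -/

/-- Every section of `π_* 𝒪_S` is locally in the image of `sumMap`. -/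
lemma exists_sumMap_eq_restrict (ha : ∀ j : Fin n, IsHolSection L ((j : ℕ) + 1) (a j))
    (U : Opens X) (f : pushforward (curve a) U) (x₀ : U) :
    ∃ (V : Opens X) (h : V ≤ U) (c : (i : Fin n) → negPowSections L i V),
      (x₀ : X) ∈ V ∧ sumMap a V c = resPushforward (curve a) h f := by
  set e := trivializationAt ℂ L (x₀ : X)
  have hx₀ : (x₀ : X) ∈ e.baseSet := FiberBundle.mem_baseSet_trivializationAt' _
  have hs₀ : (x₀ : X) ∈ (chartAt ℂ (x₀ : X)).source := mem_chart_source ℂ _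
  set φ := chartAt ℂ (x₀ : X)
  have hφ : φ.symm (φ x₀) = x₀ := φ.left_inv hs₀
  -- the function `f` in coordinates, extended by zero off `S`
  set g : TotalSpace ℂ L → ℂ := Function.extend
    (fun w : preim (curve a) U => ((w : curve a) : TotalSpace ℂ L)) f.1 0 with hg
  have hgw : ∀ w : preim (curve a) U, g ((w : curve a) : TotalSpace ℂ L) = f.1 w := fun w =>
    (Subtype.val_injective.comp Subtype.val_injective).extend_apply f.1 0 w
  have hnear : ∀ᶠ z in 𝓝 (φ x₀), φ.symm z ∈ e.baseSet ∩ U :=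
    (φ.continuousAt_symm (mem_chart_target ℂ (x₀ : X))).eventually_mem
      ((e.open_baseSet.inter U.2).mem_nhds (by rw [hφ]; exact ⟨hx₀, x₀.2⟩))
  have hp₀ : φ.symm (φ x₀) ∈ e.baseSet := by rwa [hφ]
  obtain ⟨c, hca, hc⟩ := exists_analyticAt_coeff (f := g ∘ totPoint e (x₀ : X))
    (analyticAt_polyCoeff ha hx₀) (by
      intro t ht
      have hpt := contMDiffAt_totPoint (e := e) (x₀ := (x₀ : X)) (p := (φ x₀, t)) hp₀
        (mem_chart_target ℂ (x₀ : X))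
      obtain ⟨N, F, hN, hyN, hF, hfF⟩ := f.2 ⟨⟨totPoint e (x₀ : X) (φ x₀, t),
        (totPoint_mem_curve_iff hp₀).2 ht⟩,
        show (totPoint e (x₀ : X) (φ x₀, t)).proj ∈ U by
          rw [proj_totPoint hp₀, hφ]; exact x₀.2⟩
      refine ⟨F ∘ totPoint e (x₀ : X), ContDiffAt.analyticAt (contMDiffAt_iff_contDiffAt.1
        (ContMDiffAt.comp (I' := 𝓘(ℂ).prod 𝓘(ℂ)) _ (hF.contMDiffAt (hN.mem_nhds hyN)) hpt)), ?_⟩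
      filter_upwards [(continuous_fst.tendsto (φ x₀, t)).eventually hnear,
        hpt.continuousAt.eventually_mem (hN.mem_nhds hyN)] with p hp hpN hp0
      have hpU : (totPoint e (x₀ : X) p).proj ∈ U := by rw [proj_totPoint hp.1]; exact hp.2
      have hpS := (totPoint_mem_curve_iff (a := a) hp.1).2 hp0
      exact (hgw ⟨⟨_, hpS⟩, hpU⟩).trans (hfF ⟨⟨_, hpS⟩, hpU⟩ hpN))
  have hall : ∀ᶠ x in 𝓝 (x₀ : X), x ∈ U ∧ x ∈ e.baseSet ∧ x ∈ φ.source ∧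
      (∀ k, AnalyticAt ℂ (c k) (φ x)) ∧
      ∀ t, monicFamily (fun k => polyCoeff e a k ∘ φ.symm) (φ x, t) = 0 →
        (g ∘ totPoint e (x₀ : X)) (φ x, t) = ∑ k : Fin n, c k (φ x) * t ^ (k : ℕ) := by
    have h1 := (φ.continuousAt hs₀).eventually
      ((Filter.eventually_all.2 fun k => (hca k).eventually_analyticAt).and hc)
    filter_upwards [U.2.mem_nhds x₀.2, e.open_baseSet.mem_nhds hx₀, φ.open_source.mem_nhds hs₀, h1]
      with x h2 h3 h4 h5
    exact ⟨h2, h3, h4, h5⟩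
  obtain ⟨V, hV, hVo, hxV⟩ := eventually_nhds_iff.1 hall
  refine ⟨⟨V, hVo⟩, fun x hx => (hV x hx).1,
    fun k => ⟨fun x => c k (φ x) • powCoord e k x, fun e' _ x hx => ?_⟩, hxV, ?_⟩
  · have hxV' := hV x x.2
    refine ContMDiffAt.contMDiffWithinAt ?_
    refine (contMDiffAt_subtype_iff (f := fun z : X => (c k (φ z) • powCoord e k z)
      (PiTensorProduct.tprod ℂ fun _ : Fin k => frame e' z))).2 ?_
    have h1 := (contMDiffAt_comp_chartAt hxV'.2.2.1 (hxV'.2.2.2.1 k)).mul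
      ((contMDiffAt_linearMapAt_frame e e' hxV'.2.1 hx).pow (k : ℕ))
    refine h1.congr_of_eventuallyEq (Eventually.of_forall fun z => ?_)
    simp [powCoord_tprod, φ]
  · refine Subtype.ext (funext fun w => ?_)
    set y : TotalSpace ℂ L := ((w : curve a) : TotalSpace ℂ L) with hy
    obtain ⟨hU, hb, hs, -, heq⟩ := hV y.proj w.2
    have h0 := (mem_curve_iff (x₀ := (x₀ : X)) hb hs).1 (w : curve a).2
    have h1 := heq (e y).2 h0
    have h2 : totPoint e (x₀ : X) (φ y.proj, (e y).2) = y := totPoint_totCoord hb hs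
    rw [Function.comp_apply, h2] at h1
    have h3 : ∑ k : Fin n, (c k (φ y.proj) • powCoord e k y.proj) (tautPow L k y) =
        ∑ k : Fin n, c k (φ y.proj) * (e y).2 ^ (k : ℕ) :=
      Finset.sum_congr rfl fun k _ => by
        rw [LinearMap.smul_apply, powCoord_tautPow e k hb, smul_eq_mul]
    exact h3.trans (h1.symm.trans (hgw ⟨w.1, hU⟩))

/-! ### Gluing -/

lemma resPushforward_sumMap {U V : Opens X} (h : V ≤ U) (c : (i : Fin n) → negPowSections L i U) :
    resPushforward (curve a) h (sumMap a U c) = sumMap a V fun i => resNegPow L i h (c i) :=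
  rfl

/-- The local preimages given by `exists_sumMap_eq_restrict` glue, since they are unique. -/
theorem sumMap_surjective (ha : ∀ j : Fin n, IsHolSection L ((j : ℕ) + 1) (a j))
    (hS : IsSmoothCurve a) (U : Opens X) : Function.Surjective (sumMap a U) := by
  intro f
  choose V hVU c hxV hc using exists_sumMap_eq_restrict ha U f
  -- by injectivity over intersections the local solutions agree
  have hagree : ∀ (x : U) (z : V x) (i : Fin n),
      (c x i).1 z = (c ⟨z, hVU x z.2⟩ i).1 ⟨z, hxV ⟨z, hVU x z.2⟩⟩ := by
    intro x z i
    set x' : U := ⟨z, hVU x z.2⟩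
    have h1 : (fun i : Fin n => resNegPow L i (inf_le_left : V x ⊓ V x' ≤ V x) (c x i)) =
        fun i : Fin n => resNegPow L i (inf_le_right : V x ⊓ V x' ≤ V x') (c x' i) := by
      refine sumMap_injective ha hS (V x ⊓ V x') ?_
      rw [← resPushforward_sumMap, ← resPushforward_sumMap, hc, hc]
      rfl
    exact congrFun (congrArg Subtype.val (congrFun h1 i)) ⟨z, z.2, hxV x'⟩
  refine ⟨fun i => ⟨fun x => (c x i).1 ⟨x, hxV x⟩, fun e _ x hx => ?_⟩, ?_⟩
  · refine ContMDiffAt.contMDiffWithinAt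
      (contMDiffAt_of_restrict (hVU x) (x := ⟨x, hxV x⟩) ?_)
    have h1 := ((c x i).2 e ⟨x, hxV x⟩ hx).contMDiffAt
      ((e.open_baseSet.preimage continuous_subtype_val).mem_nhds hx)
    refine h1.congr_of_eventuallyEq (Eventually.of_forall fun z => ?_)
    exact congrArg (fun l : NegPow L i (z : X) =>
      l (PiTensorProduct.tprod ℂ fun _ : Fin i => frame e (z : X))) (hagree x z i).symm
  · refine Subtype.ext (funext fun w => ?_)
    set x : U := projOn (curve a) U w
    exact congrFun (congrArg Subtype.val (hc x)) ⟨w.1, hxV x⟩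

end Sheaf

end SpectralCurve

theorem mainTheorem2 {X : Type*} [TopologicalSpace X] [ChartedSpace ℂ X] [IsManifold 𝓘(ℂ) ω X]
    (L : X → Type*) [∀ x, AddCommGroup (L x)] [∀ x, Module ℂ (L x)]
    [∀ x, TopologicalSpace (L x)] [TopologicalSpace (TotalSpace ℂ L)]
    [FiberBundle ℂ L] [VectorBundle ℂ ℂ L] [ContMDiffVectorBundle ω ℂ L 𝓘(ℂ)]
    (n : ℕ) (a : (j : Fin n) → (x : X) → ⨂[ℂ]^((j : ℕ) + 1) (L x))
    (ha : ∀ j : Fin n, IsHolSection L ((j : ℕ) + 1) (a j))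
    (hS : IsSmoothCurve a) :
    (∀ (U V : Opens X) (h : V ≤ U) (c : (i : Fin n) → negPowSections L i U),
      resPushforward (curve a) h (sumMap a U c) = sumMap a V fun i => resNegPow L i h (c i)) ∧
    ∀ U : Opens X, Function.Bijective (sumMap a U) :=
  ⟨fun _ _ h c => resPushforward_sumMap h c,
    fun U => ⟨sumMap_injective ha hS U, sumMap_surjective ha hS U⟩⟩
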